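/- Let $\alpha>0$ and $\beta,c\in\mathbb R$, and define $T_{\alpha,\beta}:\mathbb R\to\mathbb R$ by $$T_{\alpha,\beta}(x)=\frac{\alpha}{2}\left(\frac{x+\beta}{\alpha}-\frac{\alpha}{x-\beta}\right)\ (x\neq\beta),\qquad T_{\alpha,\beta}(\beta)=\beta .$$ Let $f$ be a meromorphic function on the half plane $\mathbb H_c=\{z\in\mathbb C:\Re z>c\}$ such that: (1) there are $K>0$ and $c'>c$ with $|f(\sigma+it)|\le K$ for all $\sigma>c'$ and $t\in\mathbb R$; (2) there is a non-increasing $\nu:(c,\infty)\to\mathbb R$ with $\nu(\sigma)\le 1+c-\sigma$ for all $\sigma>c$ sufficiently near $c$, such that for every $\sigma>c$ and every $\varepsilon>0$ one has $f(\sigma+it)=O(|t|^{\nu(\sigma)+\varepsilon})$ as $|t|\to\infty$; (3) $f$ has at most one pole in $\mathbb H_c$. For $Z\subseteq\mathbb Z\times\{1,2,\dots\}$ and real $h$, $a>0$ put $Z^h=\{(n,k)\in Z:k\ge h\}$, $$Z^h_a=\{(z,r)\in\mathbb Z^2: |z-y|<a(r-q)\text{ for some }(y,q)\in Z^h\},\qquad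 Z^h_a(\lambda)=\{m\in\mathbb Z:(m,\lambda)\in Z^h_a\}.$$ A sequence $(n_l,k_l)_{l\ge1}$ of pairs of natural numbers is called Stoltz if there are a set $Z\subseteq\mathbb Z\times\{1,2,\dots\}$ and a function $h$ with $h(t)\to\infty$ as $t\to\infty$ such that $(n_l,k_l)\in Z^{h(t)}$ for all $l\ge t\ge1$, and there are $h_0,a_0,A>0$ such that $|Z^{h_0}_{a_0}(\lambda)|\le A\lambda$ for all integers $\lambda>0$. Let $(n_l,k_l)_{l\ge1}$ be Stoltz, and let $s\in\mathbb H_c$; if $f$ has a pole $s_0$ in $\mathbb H_c$, assume in addition that $\Re s\ne\Re s_0$. Then the integral below converges absolutely, and for Lebesgue-almost every $x\in\mathbb R$ $$\lim_{l\to\infty}\frac1{k_l}\sum_{j=1}^{k_l}f\bigl(s+iT_{\alpha,\beta}^{\,n_l+j}(x)\bigr)=\frac{\alpha}{\pi}\int_{\mathbb R}\frac{f(s+i\tau)}{\alpha^2+(\tau-\beta)^2}\,d\tau .$$ -/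

import Mathlib

open Filter Topology Asymptotics MeasureTheory

/-- The open half plane of complex numbers with real part greater than `c`. -/
def rightHalfPlane (c : ℝ) : Set ℂ := {z | c < z.re}

/-- The poles of `f` in `U`: the points of `U` where the Laurent expansion of `f` has
a lowest term of negative degree. -/
noncomputable def polesIn (f : ℂ → ℂ) (U : Set ℂ) : Set ℂ :=
  {z | z ∈ U ∧ meromorphicOrderAt f z < 0}

/-- `f` is a meromorphic function on `U` in the classical sense: at every point it has a Laurent
expansion with finite principal part, and it is holomorphic at every point that is not a pole
(so `f` carries no wrong values at removable singularities; its values at poles are arbitrary). -/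
def IsMeromorphicFunctionOn (f : ℂ → ℂ) (U : Set ℂ) : Prop :=
  MeromorphicOn f U ∧ ∀ z ∈ U, z ∉ polesIn f U → AnalyticAt ℂ f z

/-- The Boole-type map `T_{α,β}` of the real line, fixing `β` by convention. -/
noncomputable def booleMap (α β : ℝ) (x : ℝ) : ℝ :=
  if x = β then β else α / 2 * ((x + β) / α - α / (x - β))

/-- `Z^h`: the points `(n, k)` of `Z` with `k ≥ h`. -/
def heightTrunc (Z : Set (ℤ × ℕ)) (h : ℝ) : Set (ℤ × ℕ) :=
  {p | p ∈ Z ∧ h ≤ (p.2 : ℝ)}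

/-- The lattice points in the union of the open upward cones of aperture `a` whose vertices
are in `W`. -/
def coneHull (W : Set (ℤ × ℕ)) (a : ℝ) : Set (ℤ × ℤ) :=
  {q | ∃ p ∈ W, |(q.1 : ℝ) - (p.1 : ℝ)| < a * ((q.2 : ℝ) - (p.2 : ℝ))}

/-- The horizontal slice of a set of lattice points at height `lam`. -/
def latticeSlice (V : Set (ℤ × ℤ)) (lam : ℤ) : Set ℤ := {m | (m, lam) ∈ V}

/-- The sequence of pairs `(n l, k l)`, `l ≥ 1`, is Stoltz. -/
def IsStoltz (n k : ℕ → ℕ) : Prop :=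
  ∃ Z : Set (ℤ × ℕ), (∀ p ∈ Z, 1 ≤ p.2) ∧
    (∃ h : ℕ → ℝ, Tendsto h atTop atTop ∧
      ∀ t ≥ 1, ∀ l ≥ t, ((n l : ℤ), k l) ∈ heightTrunc Z (h t)) ∧
    ∃ h₀ > (0 : ℝ), ∃ a₀ > (0 : ℝ), ∃ A > (0 : ℝ), ∀ lam : ℕ, 0 < lam →
      (latticeSlice (coneHull (heightTrunc Z h₀) a₀) lam).Finite ∧
      ((latticeSlice (coneHull (heightTrunc Z h₀) a₀) lam).ncard : ℝ) ≤ A * lam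

/-! The substitution x = β + α cot w turns `booleMap` into the doubling map u ↦ 2u of ℝ/πℤ, and Haar
measure into the Cauchy law with density α / (π(α² + (τ - β)²)) (`booleMap_cot`,
`integral_cotLift`). The claim is thus a pointwise ergodic theorem for moving averages of the
doubling map, applied to φ(τ) = f(s + iτ). This φ is continuous, since no pole lies on the line Re z
= Re s, and grows more slowly than some power |τ|^q with q < 1, so it is integrable against the
Cauchy law (`integrable_div_cauchy`).

The ergodic theorem follows the Banach principle. The Stoltz condition gives a weak type (1, 1)
inequality for the maximal moving average: a covering argument on ℕ (`card_exceedance_le`) is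
transferred along orbits (`measure_exceedance_le`). Hence convergence almost everywhere passes to L¹
limits (`MovingAveragesConverge.of_approx`). A bounded function minus one of its Birkhoff averages
is a coboundary, whose window sums telescope. For a nontrivial character the Birkhoff averages tend
to 0 in L¹ by orthogonality, so it is an L¹ limit of such coboundaries; trigonometric polynomials
are dense in L¹. -/

/-! ### Maximal inequality for Stoltz windows -/

/-- The condition under which one-sided averages over the windows `(n, n + k]`, `(n, k) ∈ W`, satisfy
a weak type inequality: the cone hull of `W` has slices of at most linear growth. -/
def HasLinearSlices (W : Set (ℤ × ℕ)) (a A : ℝ) : Prop :=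
  ∀ lam : ℕ, 0 < lam → (latticeSlice (coneHull W a) lam).Finite ∧
    ((latticeSlice (coneHull W a) lam).ncard : ℝ) ≤ A * lam

/-- Nagel--Stein covering argument on the natural numbers: the set of base points at which some
window average exceeds `δ` has size at most a multiple of the mass divided by `δ`. -/
theorem card_exceedance_le {W : Set (ℤ × ℕ)} {a A : ℝ} (ha : 0 < a) (hA : 0 < A)
    (hW : HasLinearSlices W a A) (P : Finset (ℕ × ℕ))
    (hP : ∀ p ∈ P, ((p.1 : ℤ), p.2) ∈ W ∧ 1 ≤ p.2) (φ : ℕ → ℝ) (hφ : ∀ i, 0 ≤ φ i)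
    {δ : ℝ} (hδ : 0 ≤ δ) (N M : ℕ) (hM : ∀ p ∈ P, p.1 + p.2 < M) :
    δ * (((Finset.range N).filter fun i =>
      ∃ p ∈ P, δ * p.2 < ∑ j ∈ Finset.Icc 1 p.2, φ (p.1 + j + i)).card : ℝ) ≤
      A * ⌈2 + 2 / a⌉₊ * ∑ i ∈ Finset.range (N + M), φ i := by
  classical
  -- Chosen so that a(Q - 2) ≥ 2: at height Qk, a cone with vertex at height at most 2k has
  -- half-width at least 2k.
  set Q : ℕ := ⌈2 + 2 / a⌉₊ with hQ
  have hQa : 2 + 2 / a ≤ Q := Nat.le_ceil _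
  have hQpos : 0 < Q := by
    have : (0 : ℝ) < Q := lt_of_lt_of_le (by positivity) hQa
    exact_mod_cast this
  set bad := (Finset.range N).filter fun i =>
      ∃ p ∈ P, δ * p.2 < ∑ j ∈ Finset.Icc 1 p.2, φ (p.1 + j + i) with hbad
  let t : Finset (ℕ × ℕ × ℕ) := ((Finset.range N) ×ˢ P).filter fun q =>
      δ * q.2.2 < ∑ j ∈ Finset.Icc 1 q.2.2, φ (q.2.1 + j + q.1)
  let B : ℕ × ℕ × ℕ → Set ℕ := fun q => ↑(Finset.Ioc (q.2.1 + q.1) (q.2.1 + q.1 + q.2.2))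
  have hne : ∀ q ∈ (t : Set (ℕ × ℕ × ℕ)), (B q).Nonempty := by
    intro q hq
    have hq' : q ∈ t := hq
    simp only [t, Finset.mem_filter, Finset.mem_product] at hq'
    have := (hP _ hq'.1.2).2
    exact ⟨q.2.1 + q.1 + 1, by simp [B]; omega⟩
  -- Every exceeding window meets a selected one at least half as long, and the selected windows are
  -- disjoint.
  obtain ⟨u, hut, hdisj, hcov⟩ := Vitali.exists_disjoint_subfamily_covering_enlargement B
    (t : Set (ℕ × ℕ × ℕ)) (fun q => (q.2.2 : ℝ)) 2 (by norm_num) (fun q _ => by positivity)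
    (∑ q ∈ t, (q.2.2 : ℝ))
    (fun q hq => Finset.single_le_sum (f := fun q : ℕ × ℕ × ℕ => (q.2.2 : ℝ))
      (fun _ _ => by positivity) hq) hne
  have hufin : u.Finite := t.finite_toSet.subset hut
  set U := hufin.toFinset with hU
  have hUt : ∀ q ∈ U, q ∈ t := fun q hq => hut (by simpa [U] using hq)
  have hUmem : ∀ q ∈ U, q.1 < N ∧ q.2 ∈ P ∧
      δ * q.2.2 < ∑ j ∈ Finset.Icc 1 q.2.2, φ (q.2.1 + j + q.1) := by
    intro q hq
    have := hUt q hq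
    simp only [t, Finset.mem_filter, Finset.mem_product, Finset.mem_range] at this
    exact ⟨this.1.1, this.1.2, this.2⟩
  let S : ℕ × ℕ × ℕ → Set ℤ := fun q => latticeSlice (coneHull W a) ((Q * q.2.2 : ℕ) : ℤ)
  have hpos : ∀ q ∈ U, 0 < Q * q.2.2 := fun q hq =>
    Nat.mul_pos hQpos (hP _ (hUmem q hq).2.1).2
  -- The base points charged to the selected window `q`. Reflecting i to (start of the window) - i
  -- places them in one slice of the cone hull, whence the linear bound.
  let F : ℕ × ℕ × ℕ → Finset ℕ := fun q => (Finset.range N).filter fun i =>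
    ((q.2.1 + q.1 : ℕ) : ℤ) - i ∈ S q
  have hFcard : ∀ q ∈ U, ((F q).card : ℝ) ≤ A * Q * q.2.2 := by
    intro q hq
    obtain ⟨hfin, hcard⟩ := hW _ (hpos q hq)
    have h1 : (F q).card ≤ (S q).ncard := by
      rw [← Set.ncard_coe_finset]
      refine Set.ncard_le_ncard_of_injOn (fun i : ℕ => ((q.2.1 + q.1 : ℕ) : ℤ) - i) ?_ ?_ hfin
      · intro i hi
        have hi' : i ∈ F q := hi
        exact (Finset.mem_filter.1 hi').2
      · intro i _ j _ hij
        simpa using hij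
    calc ((F q).card : ℝ) ≤ (S q).ncard := by exact_mod_cast h1
      _ ≤ A * ((Q * q.2.2 : ℕ) : ℝ) := hcard
      _ = _ := by push_cast; ring
  have hsub : bad ⊆ U.biUnion F := by
    intro i hi
    simp only [hbad, Finset.mem_filter, Finset.mem_range] at hi
    obtain ⟨hiN, p, hp, hex⟩ := hi
    have hit : (i, p) ∈ (t : Set (ℕ × ℕ × ℕ)) := by
      simp only [t, Finset.coe_filter, Finset.mem_product, Finset.mem_range, Set.mem_ofPred_eq]
      exact ⟨⟨hiN, hp⟩, hex⟩
    obtain ⟨q, hqu, ⟨x, hx1, hx2⟩, hk⟩ := hcov _ hit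
    have hqU : q ∈ U := by simpa [U] using hqu
    refine Finset.mem_biUnion.2 ⟨q, hqU, Finset.mem_filter.2 ⟨Finset.mem_range.2 hiN, ?_⟩⟩
    refine ⟨_, (hP p hp).1, ?_⟩
    simp only [B, Finset.coe_Ioc, Set.mem_Ioc] at hx1 hx2
    have hK : (1 : ℝ) ≤ q.2.2 := by exact_mod_cast (hP _ (hUmem q hqU).2.1).2
    have hk' : (p.2 : ℝ) ≤ 2 * q.2.2 := hk
    have hx1a : (p.1 : ℝ) + i < x := by exact_mod_cast hx1.1
    have hx1b : (x : ℝ) ≤ p.1 + i + p.2 := by exact_mod_cast hx1.2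
    have hx2a : (q.2.1 : ℝ) + q.1 < x := by exact_mod_cast hx2.1
    have hx2b : (x : ℝ) ≤ q.2.1 + q.1 + q.2.2 := by exact_mod_cast hx2.2
    have hlt : |((q.2.1 : ℝ) + q.1 - i) - p.1| < 2 * q.2.2 := by
      rw [abs_lt]; constructor <;> linarith
    have hge : 2 * (q.2.2 : ℝ) ≤ a * ((Q * q.2.2 : ℝ) - p.2) := by
      have h1 : (2 + 2 / a) * (q.2.2 : ℝ) ≤ Q * q.2.2 := by gcongr
      have h2 : 2 / a * (q.2.2 : ℝ) ≤ Q * q.2.2 - p.2 := by linarith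
      calc 2 * (q.2.2 : ℝ) = a * (2 / a * (q.2.2 : ℝ)) := by field_simp
        _ ≤ _ := by gcongr
    push_cast
    exact lt_of_lt_of_le hlt hge
  have hmass : ∑ q ∈ U, δ * (q.2.2 : ℝ) ≤ ∑ i ∈ Finset.range (N + M), φ i := by
    calc ∑ q ∈ U, δ * (q.2.2 : ℝ)
        ≤ ∑ q ∈ U, ∑ x ∈ Finset.Ioc (q.2.1 + q.1) (q.2.1 + q.1 + q.2.2), φ x := by
          refine Finset.sum_le_sum fun q hq => ((hUmem q hq).2.2.le).trans (le_of_eq ?_)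
          refine Finset.sum_bij (fun j _ => q.2.1 + j + q.1) ?_ ?_ ?_ ?_
          · intro j hj; simp only [Finset.mem_Icc, Finset.mem_Ioc] at *; omega
          · intro j _ l _ h; omega
          · intro x hx
            simp only [Finset.mem_Ioc] at hx
            exact ⟨x - (q.2.1 + q.1), by simp only [Finset.mem_Icc]; omega, by omega⟩
          · intros; rfl
      _ = ∑ x ∈ U.biUnion fun q => Finset.Ioc (q.2.1 + q.1) (q.2.1 + q.1 + q.2.2), φ x := by
          rw [Finset.sum_biUnion]
          intro q hq r hr hqr
          have := hdisj (by simpa [U] using hq) (by simpa [U] using hr) hqr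
          exact Finset.disjoint_coe.1 this
      _ ≤ _ := by
          refine Finset.sum_le_sum_of_subset_of_nonneg ?_ fun i _ _ => hφ i
          intro x hx
          obtain ⟨q, hq, hx⟩ := Finset.mem_biUnion.1 hx
          have h1 := hM _ (hUmem q hq).2.1
          have h2 := (hUmem q hq).1
          simp only [Finset.mem_Ioc, Finset.mem_range] at *
          omega
  have hcard : (bad.card : ℝ) ≤ ∑ q ∈ U, A * Q * (q.2.2 : ℝ) := by
    calc (bad.card : ℝ) ≤ ∑ q ∈ U, ((F q).card : ℝ) := by
          exact_mod_cast (Finset.card_le_card hsub).trans Finset.card_biUnion_le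
      _ ≤ _ := Finset.sum_le_sum hFcard
  calc δ * (bad.card : ℝ) ≤ δ * ∑ q ∈ U, A * Q * (q.2.2 : ℝ) := by gcongr
    _ = A * Q * ∑ q ∈ U, δ * (q.2.2 : ℝ) := by
        rw [Finset.mul_sum, Finset.mul_sum]; exact Finset.sum_congr rfl fun _ _ => by ring
    _ ≤ _ := by gcongr

variable {X : Type*} [MeasurableSpace X]

/-- Weak type `(1, 1)` inequality for finitely many windows, by transference. -/
theorem measure_exceedance_le (μ : Measure X) [IsProbabilityMeasure μ] {T : X → X}
    (hT : MeasurePreserving T μ μ) {W : Set (ℤ × ℕ)} {a A : ℝ} (ha : 0 < a) (hA : 0 < A)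
    (hW : HasLinearSlices W a A) (P : Finset (ℕ × ℕ))
    (hP : ∀ p ∈ P, ((p.1 : ℤ), p.2) ∈ W ∧ 1 ≤ p.2) {g : X → ℝ} (hgm : Measurable g)
    (hg : Integrable g μ) (hg0 : ∀ x, 0 ≤ g x) {δ : ℝ} (hδ : 0 ≤ δ) :
    δ * μ.real {x | ∃ p ∈ P, δ * p.2 < ∑ j ∈ Finset.Icc 1 p.2, g (T^[p.1 + j] x)} ≤
      A * ⌈2 + 2 / a⌉₊ * ∫ x, g x ∂μ := by
  classical
  set E := {x | ∃ p ∈ P, δ * p.2 < ∑ j ∈ Finset.Icc 1 p.2, g (T^[p.1 + j] x)} with hE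
  have hEm : MeasurableSet E := by
    have : E = ⋃ p ∈ P, {x | δ * p.2 < ∑ j ∈ Finset.Icc 1 p.2, g (T^[p.1 + j] x)} := by
      ext; simp [hE]
    rw [this]
    refine P.measurableSet_biUnion fun p _ => measurableSet_lt measurable_const ?_
    exact Finset.measurable_sum _ fun j _ => hgm.comp (hT.measurable.iterate _)
  set C := A * ⌈2 + 2 / a⌉₊ with hC
  have hC0 : 0 ≤ C := by positivity
  obtain ⟨M, hM⟩ : ∃ M : ℕ, ∀ p ∈ P, p.1 + p.2 < M :=
    ⟨∑ p ∈ P, (p.1 + p.2) + 1, fun p hp => Nat.lt_succ_of_le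
      (Finset.single_le_sum (f := fun p : ℕ × ℕ => p.1 + p.2) (fun _ _ => Nat.zero_le _) hp)⟩
  have hI : 0 ≤ ∫ x, g x ∂μ := integral_nonneg hg0
  have hcomp : ∀ i, Integrable (fun x => g (T^[i] x)) μ := fun i =>
    (hT.iterate i).integrable_comp_of_integrable hg
  have hcompI : ∀ i, ∫ x, g (T^[i] x) ∂μ = ∫ x, g x ∂μ := fun i => by
    rw [← integral_map (hT.iterate i).measurable.aemeasurable
      (by rw [(hT.iterate i).map_eq]; exact hg.aestronglyMeasurable), (hT.iterate i).map_eq]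
  have hind : Integrable (E.indicator fun _ => (1 : ℝ)) μ :=
    (integrable_const _).indicator hEm
  have hindc : ∀ i, Integrable (fun x => E.indicator (fun _ => (1 : ℝ)) (T^[i] x)) μ := fun i =>
    (hT.iterate i).integrable_comp_of_integrable hind
  have hindI : ∀ i, ∫ x, E.indicator (fun _ => (1 : ℝ)) (T^[i] x) ∂μ = μ.real E := fun i => by
    rw [← integral_map (hT.iterate i).measurable.aemeasurable
      (by rw [(hT.iterate i).map_eq]; exact hind.aestronglyMeasurable), (hT.iterate i).map_eq,
      integral_indicator hEm]
    simp
  -- Transference: the counting bound for i ↦ g(Tⁱx) is integrated over x. The excess M comes from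
  -- windows protruding beyond N and disappears after division by N → ∞.
  have key : ∀ N : ℕ, δ * (N * μ.real E) ≤ C * ((N + M) * ∫ x, g x ∂μ) := by
    intro N
    have h1 : ∀ x, δ * ∑ i ∈ Finset.range N, E.indicator (fun _ => (1 : ℝ)) (T^[i] x) ≤
        C * ∑ i ∈ Finset.range (N + M), g (T^[i] x) := by
      intro x
      have := card_exceedance_le ha hA hW P hP (fun i => g (T^[i] x)) (fun _ => hg0 _) hδ N M hM
      refine le_trans (le_of_eq ?_) this
      congr 1
      rw [Finset.card_filter]
      push_cast
      refine Finset.sum_congr rfl fun i _ => ?_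
      simp only [Set.indicator_apply, hE, Set.mem_ofPred_eq, ← Function.iterate_add_apply]
    have h2 := integral_mono (μ := μ)
      ((integrable_finsetSum _ fun i _ => hindc i).const_mul δ)
      ((integrable_finsetSum _ fun i _ => hcomp i).const_mul C) h1
    rw [integral_const_mul, integral_const_mul, integral_finsetSum _ fun i _ => hindc i,
      integral_finsetSum _ fun i _ => hcomp i] at h2
    simpa [hindI, hcompI] using h2
  have hlim : Tendsto (fun N : ℕ => C * ((1 + (M : ℝ) / N) * ∫ x, g x ∂μ)) atTop
      (𝓝 (C * ((1 + 0) * ∫ x, g x ∂μ))) := by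
    refine ((tendsto_const_nhds.add ?_).mul_const _).const_mul _
    exact tendsto_const_div_atTop_nhds_zero_nat _
  rw [add_zero, one_mul] at hlim
  refine ge_of_tendsto hlim ?_
  filter_upwards [eventually_gt_atTop 0] with N hN
  have hN' : (0 : ℝ) < N := by exact_mod_cast hN
  have := key N
  rw [← mul_le_mul_iff_right₀ hN']
  calc N * (δ * μ.real E) = δ * (N * μ.real E) := by ring
    _ ≤ _ := this
    _ = _ := by field_simp

/-- Weak type `(1, 1)` inequality for a sequence of windows. -/
theorem measure_iUnion_exceedance_le (μ : Measure X) [IsProbabilityMeasure μ] {T : X → X}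
    (hT : MeasurePreserving T μ μ) {W : Set (ℤ × ℕ)} {a A : ℝ} (ha : 0 < a) (hA : 0 < A)
    (hW : HasLinearSlices W a A) {n k : ℕ → ℕ} {L : ℕ}
    (hnk : ∀ l ≥ L, ((n l : ℤ), k l) ∈ W ∧ 1 ≤ k l) {g : X → ℝ} (hgm : Measurable g)
    (hg : Integrable g μ) (hg0 : ∀ x, 0 ≤ g x) {δ : ℝ} (hδ : 0 < δ) :
    μ {x | ∃ l ≥ L, δ * k l < ∑ j ∈ Finset.Icc 1 (k l), g (T^[n l + j] x)} ≤
      ENNReal.ofReal (A * ⌈2 + 2 / a⌉₊ / δ * ∫ x, g x ∂μ) := by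
  classical
  let P : ℕ → Finset (ℕ × ℕ) := fun m => (Finset.Icc L m).image fun l => (n l, k l)
  let E : ℕ → Set X := fun m =>
    {x | ∃ p ∈ P m, δ * p.2 < ∑ j ∈ Finset.Icc 1 p.2, g (T^[p.1 + j] x)}
  have hmono : Monotone E := by
    rintro m m' hm x ⟨p, hp, hx⟩
    exact ⟨p, Finset.image_subset_image (Finset.Icc_subset_Icc_right hm) hp, hx⟩
  have hsub : {x | ∃ l ≥ L, δ * k l < ∑ j ∈ Finset.Icc 1 (k l), g (T^[n l + j] x)} ⊆
      ⋃ m, E m := by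
    rintro x ⟨l, hl, hx⟩
    refine Set.mem_iUnion.2 ⟨l, (n l, k l), ?_, hx⟩
    exact Finset.mem_image.2 ⟨l, Finset.mem_Icc.2 ⟨hl, le_rfl⟩, rfl⟩
  refine (measure_mono hsub).trans ?_
  rw [hmono.measure_iUnion]
  refine iSup_le fun m => ?_
  have hPm : ∀ p ∈ P m, ((p.1 : ℤ), p.2) ∈ W ∧ 1 ≤ p.2 := by
    intro p hp
    obtain ⟨l, hl, rfl⟩ := Finset.mem_image.1 hp
    exact hnk l (Finset.mem_Icc.1 hl).1
  have := measure_exceedance_le μ hT ha hA hW (P m) hPm hgm hg hg0 hδ.le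
  rw [← ofReal_measureReal]
  refine ENNReal.ofReal_le_ofReal ?_
  rw [div_mul_eq_mul_div, le_div_iff₀ hδ, mul_comm]
  exact this

/-! ### Convergence of moving averages: coboundaries and L¹ closure -/

/-- The averages of `g` along the orbit of `x` over the windows `(n l, n l + k l]`. -/
noncomputable def movingAverage (T : X → X) (n k : ℕ → ℕ) (g : X → ℂ) (l : ℕ) (x : X) : ℂ :=
  (1 / (k l : ℂ)) * ∑ j ∈ Finset.Icc 1 (k l), g (T^[n l + j] x)

/-- The moving averages of `g` converge almost everywhere to its mean. -/
def MovingAveragesConverge (μ : Measure X) (T : X → X) (n k : ℕ → ℕ) (g : X → ℂ) : Prop :=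
  ∀ᵐ x ∂μ, Tendsto (fun l => movingAverage T n k g l x) atTop (𝓝 (∫ x, g x ∂μ))

namespace MovingAveragesConverge

variable {μ : Measure X} {T : X → X} {n k : ℕ → ℕ}

theorem const [IsProbabilityMeasure μ] (hk : Tendsto k atTop atTop) (b : ℂ) :
    MovingAveragesConverge μ T n k fun _ => b := by
  refine Eventually.of_forall fun x => ?_
  refine tendsto_const_nhds.congr' ?_
  filter_upwards [hk.eventually_gt_atTop 0] with l hl
  have : (k l : ℂ) ≠ 0 := by exact_mod_cast hl.ne'
  simp [movingAverage, this]

theorem add {g g' : X → ℂ} (hg : Integrable g μ) (hg' : Integrable g' μ)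
    (h : MovingAveragesConverge μ T n k g) (h' : MovingAveragesConverge μ T n k g') :
    MovingAveragesConverge μ T n k fun x => g x + g' x := by
  filter_upwards [h, h'] with x hx hx'
  rw [integral_add hg hg']
  refine (hx.add hx').congr fun l => ?_
  simp [movingAverage, Finset.sum_add_distrib, mul_add]

theorem const_mul {g : X → ℂ} (b : ℂ) (h : MovingAveragesConverge μ T n k g) :
    MovingAveragesConverge μ T n k fun x => b * g x := by
  filter_upwards [h] with x hx
  rw [integral_const_mul]
  refine (hx.const_mul b).congr fun l => ?_
  simp only [movingAverage, ← Finset.mul_sum]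
  ring

/-- Coboundaries of bounded functions. -/
theorem coboundary (hT : MeasurePreserving T μ μ) (hk : Tendsto k atTop atTop) {h : X → ℂ}
    (hint : Integrable h μ) {B : ℝ} (hB : ∀ x, ‖h x‖ ≤ B) :
    MovingAveragesConverge μ T n k fun x => h x - h (T x) := by
  have hcomp : ∫ x, h (T x) ∂μ = ∫ x, h x ∂μ := by
    rw [← integral_map hT.measurable.aemeasurable
      (by rw [hT.map_eq]; exact hint.aestronglyMeasurable), hT.map_eq]
  have hzero : ∫ x, (h x - h (T x)) ∂μ = 0 := by
    have hint' : Integrable (fun x => h (T x)) μ := hT.integrable_comp_of_integrable hint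
    rw [integral_sub hint hint', hcomp, sub_self]
  refine Eventually.of_forall fun x => ?_
  rw [hzero]
  have hlim : Tendsto (fun l => 2 * B / (k l : ℝ)) atTop (𝓝 0) :=
    (tendsto_const_div_atTop_nhds_zero_nat (2 * B)).comp hk
  refine squeeze_zero_norm (fun l => ?_) hlim
  have htel : ∑ j ∈ Finset.Icc 1 (k l), (h (T^[n l + j] x) - h (T (T^[n l + j] x))) =
      h (T^[n l + 1] x) - h (T^[n l + 1 + k l] x) := by
    rw [← Finset.Ico_add_one_right_eq_Icc, Finset.sum_Ico_eq_sum_range, Nat.add_sub_cancel]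
    have := Finset.sum_range_sub' (fun j => h (T^[n l + 1 + j] x)) (k l)
    rw [add_zero] at this
    rw [← this]
    refine Finset.sum_congr rfl fun j _ => ?_
    rw [← Function.iterate_succ_apply' T]
    simp only [add_assoc, Nat.succ_eq_add_one]
  simp only [movingAverage, htel, norm_mul, norm_div, norm_one, Complex.norm_natCast]
  rw [one_div_mul_eq_div]
  gcongr
  calc _ ≤ ‖h (T^[n l + 1] x)‖ + ‖h (T^[n l + 1 + k l] x)‖ := norm_sub_le _ _
    _ ≤ 2 * B := by linarith [hB (T^[n l + 1] x), hB (T^[n l + 1 + k l] x)]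

/-- A bounded function minus one of its Birkhoff averages. -/
theorem sub_birkhoffAverage [IsFiniteMeasure μ] (hT : MeasurePreserving T μ μ)
    (hk : Tendsto k atTop atTop) {g : X → ℂ} (hgm : Measurable g) {B : ℝ} (hB : ∀ x, ‖g x‖ ≤ B)
    {N : ℕ} (hN : 0 < N) :
    MovingAveragesConverge μ T n k
      fun x => g x - (1 / (N : ℂ)) * ∑ j ∈ Finset.range N, g (T^[j] x) := by
  -- The average over j < N of the partial sums that solve g - g ∘ Tʲ = h_j - h_j ∘ T.
  let h : X → ℂ := fun x =>
    (1 / (N : ℂ)) * ∑ j ∈ Finset.range N, ∑ i ∈ Finset.range j, g (T^[i] x)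
  have hhB : ∀ x, ‖h x‖ ≤ ‖(1 / (N : ℂ))‖ * ∑ j ∈ Finset.range N, ∑ i ∈ Finset.range j, B := by
    intro x
    simp only [h, norm_mul]
    gcongr
    exact (norm_sum_le _ _).trans (Finset.sum_le_sum fun j _ =>
      (norm_sum_le _ _).trans (Finset.sum_le_sum fun i _ => hB _))
  have hhm : Measurable h := by
    refine measurable_const.mul (Finset.measurable_sum _ fun j _ =>
      Finset.measurable_sum _ fun i _ => hgm.comp (hT.measurable.iterate i))
  have hint : Integrable h μ := Integrable.of_bound hhm.aestronglyMeasurable _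
    (Eventually.of_forall hhB)
  have hN' : (N : ℂ) ≠ 0 := by exact_mod_cast hN.ne'
  convert coboundary (n := n) hT hk hint hhB using 2 with x
  have : ∀ j, ∑ i ∈ Finset.range j, g (T^[i] x) - ∑ i ∈ Finset.range j, g (T^[i] (T x)) =
      g x - g (T^[j] x) := by
    intro j
    rw [← Finset.sum_sub_distrib]
    have := Finset.sum_range_sub' (fun j => g (T^[j] x)) j
    simpa [Function.iterate_succ_apply] using this
  simp only [h, ← mul_sub, ← Finset.sum_sub_distrib]
  simp only [Finset.sum_sub_distrib, this]
  simp
  field_simp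

/-- The set of functions with convergent moving averages is closed in `L¹`. -/
theorem of_approx [IsProbabilityMeasure μ] (hT : MeasurePreserving T μ μ) {W : Set (ℤ × ℕ)}
    {a A : ℝ} (ha : 0 < a) (hA : 0 < A) (hW : HasLinearSlices W a A) {L : ℕ}
    (hnk : ∀ l ≥ L, ((n l : ℤ), k l) ∈ W ∧ 1 ≤ k l) {g : X → ℂ} (hgm : Measurable g)
    (hg : Integrable g μ)
    (happ : ∀ η > 0, ∃ g' : X → ℂ, Measurable g' ∧ Integrable g' μ ∧
      MovingAveragesConverge μ T n k g' ∧ ∫ x, ‖g x - g' x‖ ∂μ ≤ η) :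
    MovingAveragesConverge μ T n k g := by
  have key : ∀ δ > 0, ∀ᵐ x ∂μ, ∀ᶠ l in atTop,
      ‖movingAverage T n k g l x - ∫ x, g x ∂μ‖ ≤ 3 * δ := by
    intro δ hδ
    set C : ℝ := A * ⌈2 + 2 / a⌉₊ / δ with hC
    have hC0 : 0 ≤ C := by positivity
    rw [ae_iff]
    refine nonpos_iff_eq_zero.1 (ENNReal.le_of_forall_pos_le_add fun ε hε _ => ?_)
    have hε' : (0 : ℝ) < ε := hε
    -- The bound δ controls the difference of the means; ε / (C + 1) makes the exceptional set of
    -- the weak type inequality smaller than ε.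
    obtain ⟨g', hgm', hg', hconv, happr⟩ := happ (min δ (ε / (C + 1)))
      (lt_min hδ (by positivity))
    have hweak := measure_iUnion_exceedance_le μ hT ha hA hW hnk (g := fun x => ‖g x - g' x‖)
      (hgm.sub hgm').norm (hg.sub hg').norm (fun _ => norm_nonneg _) hδ
    have hsub : {x | ¬ ∀ᶠ l in atTop, ‖movingAverage T n k g l x - ∫ x, g x ∂μ‖ ≤ 3 * δ} ⊆
        {x | ¬ Tendsto (fun l => movingAverage T n k g' l x) atTop (𝓝 (∫ x, g' x ∂μ))} ∪
        {x | ∃ l ≥ L, δ * k l < ∑ j ∈ Finset.Icc 1 (k l),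
          ‖g (T^[n l + j] x) - g' (T^[n l + j] x)‖} := by
      intro x hx
      by_contra hcon
      simp only [Set.mem_union, Set.mem_ofPred_eq, not_or, not_not, not_exists, not_and,
        not_lt] at hcon
      refine hx ?_
      have h1 := Metric.tendsto_nhds.1 hcon.1 δ hδ
      filter_upwards [h1, eventually_ge_atTop L] with l hl hL
      have hk0 : (0 : ℝ) < k l := by exact_mod_cast (hnk l hL).2
      have h2 : ‖movingAverage T n k g l x - movingAverage T n k g' l x‖ ≤ δ := by
        simp only [movingAverage, ← mul_sub, ← Finset.sum_sub_distrib, norm_mul, norm_div,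
          norm_one, Complex.norm_natCast]
        rw [one_div_mul_eq_div, div_le_iff₀ hk0]
        exact (norm_sum_le _ _).trans (hcon.2 l hL)
      have h3 : ‖(∫ x, g' x ∂μ) - ∫ x, g x ∂μ‖ ≤ δ := by
        rw [norm_sub_rev, ← integral_sub hg hg']
        exact (norm_integral_le_integral_norm _).trans (happr.trans (min_le_left _ _))
      rw [dist_eq_norm] at hl
      calc _ = ‖(movingAverage T n k g l x - movingAverage T n k g' l x) +
            (movingAverage T n k g' l x - ∫ x, g' x ∂μ) +
            ((∫ x, g' x ∂μ) - ∫ x, g x ∂μ)‖ := by congr 1; ring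
        _ ≤ _ := norm_add₃_le
        _ ≤ 3 * δ := by linarith
    refine (measure_mono hsub).trans ((measure_union_le _ _).trans ?_)
    rw [ae_iff.1 hconv, zero_add, zero_add]
    refine hweak.trans ?_
    rw [← ENNReal.ofReal_coe_nnreal]
    refine ENNReal.ofReal_le_ofReal ?_
    calc C * ∫ x, ‖g x - g' x‖ ∂μ ≤ C * (ε / (C + 1)) := by
          gcongr; exact happr.trans (min_le_right _ _)
      _ = ε * (C / (C + 1)) := by ring
      _ ≤ ε * 1 := by gcongr; rw [div_le_one (by positivity)]; linarith
      _ = ε := mul_one _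
  have key' : ∀ᵐ x ∂μ, ∀ m : ℕ, ∀ᶠ l in atTop,
      ‖movingAverage T n k g l x - ∫ x, g x ∂μ‖ ≤ 3 * (1 / ((m : ℝ) + 1)) :=
    ae_all_iff.2 fun m => key _ (by positivity)
  filter_upwards [key'] with x hx
  rw [Metric.tendsto_nhds]
  intro ε hε
  obtain ⟨m, hm⟩ := exists_nat_one_div_lt (show 0 < ε / 3 by positivity)
  filter_upwards [hx m] with l hl
  rw [dist_eq_norm]
  linarith

end MovingAveragesConverge

/-! ### The doubling map on the circle -/

namespace AddCircle

variable {p : ℝ}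

theorem iterate_two_nsmul (j : ℕ) (u : AddCircle p) :
    (fun u : AddCircle p => 2 • u)^[j] u = (2 ^ j : ℕ) • u := by
  induction j with
  | zero => simp
  | succ j ih => rw [Function.iterate_succ_apply', ih, smul_smul, pow_succ']

theorem fourier_iterate_two_nsmul (m : ℤ) (j : ℕ) (u : AddCircle p) :
    fourier m ((fun u : AddCircle p => 2 • u)^[j] u) = fourier (m * 2 ^ j) u := by
  rw [iterate_two_nsmul, fourier_apply, fourier_apply, mul_smul, ← natCast_zsmul]
  push_cast
  rfl

variable [hp : Fact (0 < p)]

theorem measurePreserving_two_nsmul_haarAddCircle :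
    MeasurePreserving (fun u : AddCircle p => 2 • u) haarAddCircle haarAddCircle := by
  have h := (ergodic_nsmul (T := p) (n := 2) one_lt_two).toMeasurePreserving
  have hp0 : ENNReal.ofReal p ≠ 0 := by simpa using hp.out
  have heq : (haarAddCircle : Measure (AddCircle p)) = (ENNReal.ofReal p)⁻¹ • volume := by
    rw [volume_eq_smul_haarAddCircle, smul_smul,
      ENNReal.inv_mul_cancel hp0 ENNReal.ofReal_ne_top, one_smul]
  refine ⟨h.measurable, ?_⟩
  rw [heq, Measure.map_smul, h.map_eq]

/-- The `L¹` norm of a sum of distinct characters is at most the square root of their number. -/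
theorem integral_norm_sum_fourier_le (s : Finset ℕ) {a : ℕ → ℤ} (ha : Function.Injective a) :
    ∫ u, ‖∑ j ∈ s, fourier (a j) u‖ ∂(haarAddCircle (T := p)) ≤ √(s.card : ℝ) := by
  set v : C(AddCircle p, ℂ) := ∑ j ∈ s, fourier (a j) with hv
  have hvu : ∀ u, v u = ∑ j ∈ s, fourier (a j) u := fun u => by simp [hv]
  set F : Lp ℂ 2 (haarAddCircle (T := p)) := ∑ j ∈ s, fourierLp 2 (a j) with hF
  have hFv : F = ContinuousMap.toLp (E := ℂ) 2 haarAddCircle ℂ v := by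
    rw [hv, map_sum]
  have hnorm : ‖F‖ = √(s.card : ℝ) := by
    have := (orthonormal_fourier (T := p)).comp a ha
    have h2 := this.inner_sum (fun _ => 1) (fun _ => 1) s
    simp only [Function.comp_apply, one_smul, map_one, mul_one, Finset.sum_const,
      nsmul_eq_mul] at h2
    have h3 : ‖F‖ ^ 2 = (s.card : ℝ) := by
      rw [← inner_self_eq_norm_sq (𝕜 := ℂ), hF, h2, RCLike.natCast_re]
    rw [← h3, Real.sqrt_sq (norm_nonneg _)]
  have hae : F =ᵐ[haarAddCircle] v := by rw [hFv]; exact ContinuousMap.coeFn_toLp _ _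
  have hmeas : AEStronglyMeasurable v (haarAddCircle (T := p)) :=
    v.continuous.aestronglyMeasurable
  have hint : Integrable v (haarAddCircle (T := p)) :=
    memLp_one_iff_integrable.1 (((Lp.memLp F).ae_eq hae).mono_exponent one_le_two)
  calc ∫ u, ‖∑ j ∈ s, fourier (a j) u‖ ∂(haarAddCircle (T := p))
      = ∫ u, ‖v u‖ ∂(haarAddCircle (T := p)) := by simp_rw [hvu]
    -- On a probability space the L¹ norm is at most the L² norm, which orthonormality computes.
    _ = (eLpNorm v 1 haarAddCircle).toReal := by
        rw [integral_norm_eq_lintegral_enorm hmeas, eLpNorm_one_eq_lintegral_enorm]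
    _ ≤ (eLpNorm v 2 haarAddCircle).toReal := by
        refine ENNReal.toReal_mono ?_ (eLpNorm_le_eLpNorm_of_exponent_le one_le_two hmeas)
        exact ((Lp.memLp F).ae_eq hae).2.ne
    _ = ‖F‖ := by rw [Lp.norm_def, eLpNorm_congr_ae hae]
    _ = _ := hnorm

variable {n k : ℕ → ℕ} {W : Set (ℤ × ℕ)} {a A : ℝ} {L : ℕ}

/-- Doubling multiplies the frequency by 2, so for m ≠ 0 a Birkhoff average of length N is a mean of
N distinct characters, of L¹ norm at most 1/√N. Subtracting it leaves a coboundary that approximates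
the character. -/
theorem movingAveragesConverge_fourier (hk : Tendsto k atTop atTop) (ha : 0 < a) (hA : 0 < A)
    (hW : HasLinearSlices W a A) (hnk : ∀ l ≥ L, ((n l : ℤ), k l) ∈ W ∧ 1 ≤ k l) (m : ℤ) :
    MovingAveragesConverge haarAddCircle (fun u : AddCircle p => 2 • u) n k
      fun u => fourier m u := by
  have hT := measurePreserving_two_nsmul_haarAddCircle (p := p)
  rcases eq_or_ne m 0 with rfl | hm
  · simpa using MovingAveragesConverge.const (μ := haarAddCircle (T := p)) (n := n) hk 1
  have hcont : ∀ m : ℤ, Continuous fun u : AddCircle p => fourier m u := fun m =>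
    (fourier m).continuous
  have hnorm : ∀ (m : ℤ) (u : AddCircle p), ‖fourier m u‖ = 1 := fun m u => by
    rw [fourier_apply]; exact Circle.norm_coe _
  have hintf : ∀ m : ℤ, Integrable (fun u : AddCircle p => fourier m u) haarAddCircle := fun m =>
    Integrable.of_bound (hcont m).aestronglyMeasurable 1
      (Eventually.of_forall fun u => (hnorm m u).le)
  refine MovingAveragesConverge.of_approx hT ha hA hW hnk (hcont m).measurable (hintf m) ?_
  intro η hη
  -- Ensures 1/√N ≤ η.
  obtain ⟨N, hN⟩ := exists_nat_gt (max 1 (1 / η ^ 2))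
  have hN1 : (1 : ℝ) < N := (le_max_left _ _).trans_lt hN
  have hN2 : 1 / η ^ 2 < N := (le_max_right _ _).trans_lt hN
  have hN0 : 0 < N := by
    have : (0 : ℝ) < N := by linarith
    exact_mod_cast this
  have hinj : Function.Injective fun j : ℕ => m * 2 ^ j := by
    intro i j hij
    have : (2 : ℤ) ^ i = 2 ^ j := mul_left_cancel₀ hm hij
    exact Nat.pow_right_injective le_rfl (by exact_mod_cast this)
  refine ⟨_, ?_, ?_, MovingAveragesConverge.sub_birkhoffAverage hT hk (hcont m).measurable
    (fun u => (hnorm m u).le) hN0, ?_⟩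
  · simp only [fourier_iterate_two_nsmul]
    exact (hcont m).measurable.sub (measurable_const.mul (Finset.measurable_sum _ fun j _ =>
      (hcont _).measurable))
  · simp only [fourier_iterate_two_nsmul]
    exact (hintf m).sub ((integrable_finsetSum _ fun j _ => hintf _).const_mul _)
  · simp only [fourier_iterate_two_nsmul, sub_sub_cancel, norm_mul, norm_div, norm_one,
      Complex.norm_natCast]
    rw [integral_const_mul]
    have h1 := integral_norm_sum_fourier_le (p := p) (Finset.range N) hinj
    rw [Finset.card_range] at h1
    have hN' : (0 : ℝ) < N := by linarith
    have h2 : 1 ≤ η * √(N : ℝ) := by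
      have : √(1 / η ^ 2) ≤ √(N : ℝ) := Real.sqrt_le_sqrt hN2.le
      rw [Real.sqrt_div zero_le_one, Real.sqrt_one, Real.sqrt_sq hη.le, div_le_iff₀ hη] at this
      linarith
    calc 1 / (N : ℝ) * _ ≤ 1 / (N : ℝ) * √(N : ℝ) := by gcongr
      _ ≤ 1 / (N : ℝ) * √(N : ℝ) * (η * √(N : ℝ)) :=
          le_mul_of_one_le_right (by positivity) h2
      _ = η * (√(N : ℝ) * √(N : ℝ)) / N := by ring
      _ = η := by rw [Real.mul_self_sqrt hN'.le]; field_simp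

/-- Moving averages along the doubling map converge for every integrable function. -/
theorem movingAveragesConverge_of_integrable (hk : Tendsto k atTop atTop) (ha : 0 < a)
    (hA : 0 < A) (hW : HasLinearSlices W a A)
    (hnk : ∀ l ≥ L, ((n l : ℤ), k l) ∈ W ∧ 1 ≤ k l) {g : AddCircle p → ℂ} (hgm : Measurable g)
    (hg : Integrable g haarAddCircle) :
    MovingAveragesConverge haarAddCircle (fun u : AddCircle p => 2 • u) n k g := by
  have hT := measurePreserving_two_nsmul_haarAddCircle (p := p)
  have hintc : ∀ v : C(AddCircle p, ℂ), Integrable v haarAddCircle := fun v =>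
    Integrable.of_bound v.continuous.aestronglyMeasurable ‖v‖
      (Eventually.of_forall fun u => v.norm_coe_le_norm u)
  have hspan : ∀ v ∈ Submodule.span ℂ (Set.range (fourier (T := p))),
      MovingAveragesConverge haarAddCircle (fun u : AddCircle p => 2 • u) n k v := by
    intro v hv
    induction hv using Submodule.span_induction with
    | mem v hv =>
      obtain ⟨m, rfl⟩ := hv
      exact movingAveragesConverge_fourier hk ha hA hW hnk m
    | zero => exact MovingAveragesConverge.const hk 0
    | add v w _ _ hv hw => exact MovingAveragesConverge.add (hintc v) (hintc w) hv hw
    | smul b v _ hv => exact MovingAveragesConverge.const_mul b hv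
  refine MovingAveragesConverge.of_approx hT ha hA hW hnk hgm hg fun η hη => ?_
  obtain ⟨f, hfg, hf⟩ := hg.exists_boundedContinuous_integral_sub_le (half_pos hη)
  have hmem : f.toContinuousMap ∈ closure
      (Submodule.span ℂ (Set.range (fourier (T := p))) : Set C(AddCircle p, ℂ)) := by
    rw [← Submodule.topologicalClosure_coe, span_fourier_closure_eq_top]
    trivial
  obtain ⟨v, hv, hdist⟩ := Metric.mem_closure_iff.1 hmem (η / 2) (half_pos hη)
  refine ⟨v, v.continuous.measurable, hintc v, hspan v hv, ?_⟩
  have hfv : ∀ u, ‖f u - v u‖ ≤ η / 2 := fun u => by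
    rw [← dist_eq_norm]
    exact (ContinuousMap.dist_apply_le_dist (f := f.toContinuousMap) u).trans hdist.le
  calc ∫ u, ‖g u - v u‖ ∂haarAddCircle
      ≤ ∫ u, (‖g u - f u‖ + η / 2) ∂haarAddCircle := by
        refine integral_mono (hg.sub (hintc v)).norm
          ((hg.sub hf).norm.add (integrable_const _)) fun u => ?_
        calc ‖g u - v u‖ = ‖(g u - f u) + (f u - v u)‖ := by rw [sub_add_sub_cancel]
          _ ≤ _ := (norm_add_le _ _).trans (add_le_add_right (hfv u) _)
    _ = (∫ u, ‖g u - f u‖ ∂haarAddCircle) + η / 2 := by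
        have hint : Integrable (fun u => ‖g u - f u‖) haarAddCircle := (hg.sub hf).norm
        rw [integral_add hint (integrable_const _)]; simp
    _ ≤ η := by linarith

end AddCircle

/-! ### Conjugacy with the line through the cotangent -/

theorem Real.cot_periodic : Function.Periodic Real.cot Real.pi := fun w => by
  rw [Real.cot_eq_cos_div_sin, Real.cot_eq_cos_div_sin, Real.cos_add_pi, Real.sin_add_pi,
    neg_div_neg_eq]

/-- The map `booleMap α β` is conjugate to angle doubling; the value `cot (k π) = 0` matches the
convention at the pole of the map. -/
theorem booleMap_cot {α : ℝ} (hα : 0 < α) (β w : ℝ) :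
    booleMap α β (β + α * Real.cot w) = β + α * Real.cot (2 * w) := by
  rw [Real.cot_eq_cos_div_sin, Real.cot_eq_cos_div_sin, Real.sin_two_mul]
  unfold booleMap
  -- When sin w or cos w vanishes, cot w and cot 2w are both 0, by division by zero or because cos w
  -- = 0. Both sides then equal the fixed point β.
  by_cases hs : Real.sin w = 0
  · simp [hs]
  by_cases hc : Real.cos w = 0
  · simp [hc]
  have hne : β + α * (Real.cos w / Real.sin w) ≠ β := by
    have : α * (Real.cos w / Real.sin w) ≠ 0 := by positivity
    simpa using this
  rw [if_neg hne, Real.cos_two_mul, add_sub_cancel_left]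
  have h1 := Real.sin_sq_add_cos_sq w
  field_simp
  have h2 : Real.sin w ^ 2 = 1 - Real.cos w ^ 2 := by linarith
  rw [h2]
  ring

theorem iterate_booleMap_cot {α : ℝ} (hα : 0 < α) (β w : ℝ) (m : ℕ) :
    (booleMap α β)^[m] (β + α * Real.cot w) = β + α * Real.cot (2 ^ m * w) := by
  induction m with
  | zero => simp
  | succ m ih =>
    rw [Function.iterate_succ_apply', ih, booleMap_cot hα]
    ring_nf

instance Real.fact_pi_pos : Fact (0 < Real.pi) := ⟨Real.pi_pos⟩

/-- The angle in `(0, π)` whose cotangent is `(x - β) / α`. -/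
noncomputable def booleAngle (α β x : ℝ) : ℝ := Real.pi / 2 - Real.arctan ((x - β) / α)

theorem cot_booleAngle {α : ℝ} (hα : 0 < α) (β x : ℝ) : β + α * Real.cot (booleAngle α β x) = x := by
  rw [booleAngle, Real.cot_eq_cos_div_sin, Real.cos_pi_div_two_sub, Real.sin_pi_div_two_sub,
    ← Real.tan_eq_sin_div_cos, Real.tan_arctan]
  field_simp
  ring

theorem booleAngle_injective {α : ℝ} (hα : 0 < α) (β : ℝ) : Function.Injective (booleAngle α β) := fun x y h => by
  rw [← cot_booleAngle hα β x, h, cot_booleAngle hα β y]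

theorem booleAngle_mem (α β x : ℝ) : booleAngle α β x ∈ Set.Ioo 0 Real.pi := by
  have h1 := Real.arctan_lt_pi_div_two ((x - β) / α)
  have h2 := Real.neg_pi_div_two_lt_arctan ((x - β) / α)
  constructor <;> unfold booleAngle <;> linarith

theorem image_booleAngle {α : ℝ} (hα : 0 < α) (β : ℝ) : booleAngle α β '' Set.univ = Set.Ioo 0 Real.pi := by
  refine Set.Subset.antisymm ?_ fun w hw => ⟨β + α * Real.tan (Real.pi / 2 - w), trivial, ?_⟩
  · rintro _ ⟨x, -, rfl⟩
    exact booleAngle_mem α β x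
  · rw [booleAngle, add_sub_cancel_left, mul_div_cancel_left₀ _ hα.ne', Real.arctan_tan]
    · ring
    · linarith [hw.2]
    · linarith [hw.1]

theorem hasDerivAt_booleAngle {α : ℝ} (hα : 0 < α) (β x : ℝ) :
    HasDerivAt (booleAngle α β) (-(α / (α ^ 2 + (x - β) ^ 2))) x := by
  have h := ((((hasDerivAt_id x).sub_const β).div_const α).arctan).const_sub (Real.pi / 2)
  refine h.congr_deriv ?_
  have h1 : α ^ 2 + (x - β) ^ 2 ≠ 0 := by positivity
  have h2 : 1 + ((x - β) / α) ^ 2 = (α ^ 2 + (x - β) ^ 2) / α ^ 2 := by field_simp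
  simp only [id, h2]
  field_simp

theorem abs_deriv_booleAngle {α : ℝ} (hα : 0 < α) (β x : ℝ) :
    |(-(α / (α ^ 2 + (x - β) ^ 2)))| = α / (α ^ 2 + (x - β) ^ 2) := by
  rw [abs_neg, abs_of_nonneg (by positivity)]

/-- The inverse w ↦ β + α cot w of the angle is differentiable on (0, π), so it carries Lebesgue
null sets to null sets. -/
theorem ae_booleAngle_of_ae_haarAddCircle {α : ℝ} (hα : 0 < α) (β : ℝ)
    {Q : AddCircle Real.pi → Prop}
    (hQ : ∀ᵐ u ∂AddCircle.haarAddCircle, Q u) : ∀ᵐ x : ℝ, Q (booleAngle α β x) := by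
  have hvol : ∀ᵐ u : AddCircle Real.pi, Q u := by
    rw [AddCircle.volume_eq_smul_haarAddCircle]
    exact Measure.ae_smul_measure hQ _
  have hIoc := (AddCircle.measurePreserving_mk Real.pi 0).quasiMeasurePreserving.ae hvol
  rw [zero_add, ae_restrict_iff' measurableSet_Ioc, ae_iff] at hIoc
  set S : Set ℝ := {w | w ∈ Set.Ioo 0 Real.pi ∧ ¬ Q w} with hS
  have hS0 : volume S = 0 := by
    refine measure_mono_null ?_ hIoc
    rintro w ⟨hw, hQw⟩
    exact fun h => hQw (h (Set.Ioo_subset_Ioc_self hw))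
  have hdiff : DifferentiableOn ℝ (fun w : ℝ => β + α * (Real.cos w / Real.sin w)) S := by
    intro w hw
    have : Real.sin w ≠ 0 := (Real.sin_pos_of_mem_Ioo hw.1).ne'
    exact (((Real.differentiableAt_cos.fun_div Real.differentiableAt_sin this).const_mul α).const_add
      β).differentiableWithinAt
  rw [ae_iff]
  refine measure_mono_null ?_
    (addHaar_image_eq_zero_of_differentiableOn_of_addHaar_eq_zero volume hdiff hS0)
  intro x hx
  refine ⟨booleAngle α β x, ⟨booleAngle_mem α β x, hx⟩, ?_⟩
  have := cot_booleAngle hα β x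
  rwa [Real.cot_eq_cos_div_sin] at this

/-- The function on the circle corresponding to `φ` on the line under `w ↦ β + α cot w`. -/
noncomputable def cotLift (α β : ℝ) (φ : ℝ → ℂ) : AddCircle Real.pi → ℂ :=
  Function.Periodic.lift (f := fun w => φ (β + α * Real.cot w))
    (fun w => by simp only [Real.cot_periodic w])

theorem cotLift_coe (α β : ℝ) (φ : ℝ → ℂ) (w : ℝ) :
    cotLift α β φ (w : AddCircle Real.pi) = φ (β + α * Real.cot w) :=
  rfl

theorem measurable_cotLift (α β : ℝ) {φ : ℝ → ℂ} (hφ : Measurable φ) :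
    Measurable (cotLift α β φ) := by
  have hcot : Measurable Real.cot := by
    have : Real.cot = fun w => Real.cos w / Real.sin w := funext Real.cot_eq_cos_div_sin
    rw [this]
    exact Real.measurable_cos.div Real.measurable_sin
  -- The measurable identification of the circle with (0, π] reduces measurability to that of cot on
  -- ℝ.
  have heq : cotLift α β φ = fun u =>
      φ (β + α * Real.cot (AddCircle.measurableEquivIoc Real.pi 0 u : ℝ)) := by
    funext u
    conv_lhs => rw [← (AddCircle.measurableEquivIoc Real.pi 0).symm_apply_apply u]
    rfl
  rw [heq]
  exact hφ.comp (measurable_const.add (measurable_const.mul (hcot.comp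
    (measurable_subtype_coe.comp (AddCircle.measurableEquivIoc Real.pi 0).measurable))))

theorem cauchy_smul_eq {α : ℝ} (β : ℝ) (φ : ℝ → ℂ) (x : ℝ) :
    (α / (α ^ 2 + (x - β) ^ 2)) • φ x = (α : ℂ) * (φ x / ((α ^ 2 + (x - β) ^ 2 : ℝ) : ℂ)) := by
  rw [Complex.real_smul, Complex.ofReal_div]
  ring

theorem integrable_cotLift {α : ℝ} (hα : 0 < α) (β : ℝ) {φ : ℝ → ℂ} (hφ : Measurable φ)
    (hint : Integrable fun τ : ℝ => φ τ / ((α ^ 2 + (τ - β) ^ 2 : ℝ) : ℂ)) :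
    Integrable (cotLift α β φ) AddCircle.haarAddCircle := by
  have h1 : IntegrableOn (fun w => φ (β + α * Real.cot w)) (Set.Ioo 0 Real.pi) := by
    rw [← image_booleAngle hα β, integrableOn_image_iff_integrableOn_abs_deriv_smul
      MeasurableSet.univ (fun x _ => (hasDerivAt_booleAngle hα β x).hasDerivWithinAt)
      (booleAngle_injective hα β).injOn, integrableOn_univ]
    simp only [abs_deriv_booleAngle hα β, cot_booleAngle hα β, cauchy_smul_eq]
    exact hint.const_mul _
  have h2 : Integrable (cotLift α β φ) volume := by
    rw [← (AddCircle.measurePreserving_mk Real.pi 0).integrable_comp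
      (measurable_cotLift α β hφ).aestronglyMeasurable, zero_add]
    exact (integrableOn_Ioc_iff_integrableOn_Ioo (by simp)).2 h1
  have hp0 : ENNReal.ofReal Real.pi ≠ 0 := by simpa using Real.pi_pos
  rw [AddCircle.volume_eq_smul_haarAddCircle] at h2
  exact (integrable_smul_measure hp0 ENNReal.ofReal_ne_top).1 h2

/-- The Jacobian of the angle is the unnormalised Cauchy density; the factor 1/π comes from
normalising Haar measure on a circle of length π. -/
theorem integral_cotLift {α : ℝ} (hα : 0 < α) (β : ℝ) (φ : ℝ → ℂ) :
    ∫ u, cotLift α β φ u ∂AddCircle.haarAddCircle = ((α / Real.pi : ℝ) : ℂ) *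
      ∫ τ : ℝ, φ τ / ((α ^ 2 + (τ - β) ^ 2 : ℝ) : ℂ) := by
  rw [AddCircle.integral_haarAddCircle, ← AddCircle.integral_preimage Real.pi 0, zero_add,
    integral_Ioc_eq_integral_Ioo]
  simp only [cotLift_coe]
  rw [← image_booleAngle hα β, integral_image_eq_integral_abs_deriv_smul
    MeasurableSet.univ (fun x _ => (hasDerivAt_booleAngle hα β x).hasDerivWithinAt)
    (booleAngle_injective hα β).injOn, setIntegral_univ]
  simp only [abs_deriv_booleAngle hα β, cot_booleAngle hα β, cauchy_smul_eq]
  rw [integral_const_mul, Complex.real_smul]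
  push_cast
  ring

/-- Moving ergodic theorem for `booleMap` and functions integrable against its Cauchy law. -/
theorem ae_tendsto_movingAverage_booleMap {α : ℝ} (hα : 0 < α) (β : ℝ) {φ : ℝ → ℂ}
    (hφ : Measurable φ)
    (hint : Integrable fun τ : ℝ => φ τ / ((α ^ 2 + (τ - β) ^ 2 : ℝ) : ℂ))
    {n k : ℕ → ℕ} (hnk : IsStoltz n k) :
    ∀ᵐ x : ℝ, Tendsto (fun l => movingAverage (booleMap α β) n k φ l x) atTop
      (𝓝 (((α / Real.pi : ℝ) : ℂ) * ∫ τ : ℝ, φ τ / ((α ^ 2 + (τ - β) ^ 2 : ℝ) : ℂ))) := by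
  obtain ⟨Z, hZ, ⟨h, hh, hmem⟩, h₀, -, a, ha, A, hA, hW⟩ := hnk
  have hk : Tendsto k atTop atTop := by
    refine tendsto_atTop.2 fun b => ?_
    obtain ⟨t, htb, ht⟩ := ((hh.eventually_ge_atTop (b : ℝ)).and (eventually_ge_atTop 1)).exists
    filter_upwards [eventually_ge_atTop t] with l hl
    exact_mod_cast htb.trans (hmem t ht l hl).2
  -- From index L on, all pairs lie in the truncation at height h₀, where slices grow linearly.
  obtain ⟨L, hLh, hL⟩ := ((hh.eventually_ge_atTop h₀).and (eventually_ge_atTop 1)).exists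
  have hnk' : ∀ l ≥ L, ((n l : ℤ), k l) ∈ heightTrunc Z h₀ ∧ 1 ≤ k l := fun l hl =>
    ⟨⟨(hmem L hL l hl).1, hLh.trans (hmem L hL l hl).2⟩, hZ _ (hmem L hL l hl).1⟩
  have hconv := AddCircle.movingAveragesConverge_of_integrable hk ha hA hW hnk'
    (measurable_cotLift α β hφ) (integrable_cotLift hα β hφ hint)
  unfold MovingAveragesConverge at hconv
  rw [integral_cotLift hα β] at hconv
  filter_upwards [ae_booleAngle_of_ae_haarAddCircle hα β hconv] with x hx
  refine hx.congr fun l => ?_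
  simp only [movingAverage]
  congr 1
  refine Finset.sum_congr rfl fun j _ => ?_
  rw [AddCircle.iterate_two_nsmul]
  conv_rhs => rw [← cot_booleAngle hα β x, iterate_booleMap_cot hα]
  rw [← AddCircle.coe_nsmul, cotLift_coe, nsmul_eq_mul]
  push_cast
  rfl

/-! ### Integrability on vertical lines and conclusion -/

/-- A continuous function of growth less than linear is integrable against a Cauchy density. -/
theorem integrable_div_cauchy {φ : ℝ → ℂ} (hφ : Continuous φ) {q : ℝ} (hq : q < 1)
    (hO : φ =O[cocompact ℝ] fun t => (1 + ‖t‖) ^ q) {α : ℝ} (hα : 0 < α) (β : ℝ) :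
    Integrable fun τ : ℝ => φ τ / ((α ^ 2 + (τ - β) ^ 2 : ℝ) : ℂ) := by
  have hpos : ∀ τ : ℝ, 0 < α ^ 2 + (τ - β) ^ 2 := fun τ => by positivity
  have hcont : Continuous fun τ : ℝ => φ τ / ((α ^ 2 + (τ - β) ^ 2 : ℝ) : ℂ) :=
    hφ.div (by fun_prop) fun τ => by exact_mod_cast (hpos τ).ne'
  have hinv : (fun τ : ℝ => (((α ^ 2 + (τ - β) ^ 2 : ℝ) : ℂ))⁻¹) =O[cocompact ℝ]
      fun τ => (1 + ‖τ‖) ^ (-2 : ℝ) := by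
    obtain ⟨C, hC0, hC⟩ : ∃ C > 0, ∀ τ : ℝ, (1 + |τ|) ^ 2 ≤ C * (α ^ 2 + (τ - β) ^ 2) := by
      refine ⟨2 * (1 + |β|) ^ 2 / α ^ 2 + 2, by positivity, fun τ => ?_⟩
      have h1 : |τ| ≤ |τ - β| + |β| := by
        simpa using abs_add_le (τ - β) β
      have h2 : (1 + |τ|) ^ 2 ≤ 2 * (1 + |β|) ^ 2 + 2 * (τ - β) ^ 2 := by
        rw [← sq_abs (τ - β)]
        have : (1 + |τ|) ^ 2 ≤ ((1 + |β|) + |τ - β|) ^ 2 := by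
          gcongr ?_ ^ 2; linarith
        nlinarith [sq_nonneg ((1 + |β|) - |τ - β|)]
      have h3 : (2 * (1 + |β|) ^ 2 / α ^ 2 + 2) * (α ^ 2 + (τ - β) ^ 2) =
          2 * (1 + |β|) ^ 2 + 2 * (τ - β) ^ 2 +
            (2 * (1 + |β|) ^ 2 / α ^ 2 * (τ - β) ^ 2 + 2 * α ^ 2) := by
        field_simp; ring
      rw [h3]
      have : 0 ≤ 2 * (1 + |β|) ^ 2 / α ^ 2 * (τ - β) ^ 2 + 2 * α ^ 2 := by positivity
      linarith
    refine IsBigO.of_bound C (Eventually.of_forall fun τ => ?_)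
    have h1 : (0 : ℝ) < 1 + ‖τ‖ := by positivity
    rw [norm_inv, Complex.norm_real, Real.norm_of_nonneg (hpos τ).le,
      Real.norm_of_nonneg (by positivity), Real.rpow_neg h1.le, Real.rpow_two,
      ← div_eq_mul_inv, inv_eq_one_div, div_le_div_iff₀ (hpos τ) (by positivity), one_mul]
    exact hC τ
  -- The quotient decays with exponent 2 - q > 1.
  refine hcont.locallyIntegrable.integrable_of_isBigO_cocompact
    (g := fun τ => (1 + ‖τ‖) ^ (-(2 - q))) ?_
    ((integrable_one_add_norm (by simp; linarith)).integrableAtFilter _)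
  refine ((hO.mul hinv).congr_left fun τ => (div_eq_mul_inv _ _).symm).congr_right fun τ => ?_
  rw [← Real.rpow_add (by positivity)]
  ring_nf

theorem theorem3 (α β : ℝ) (hα : 0 < α) (c : ℝ) (f : ℂ → ℂ)
    (hf : IsMeromorphicFunctionOn f (rightHalfPlane c))
    (hbdd : ∃ K > (0 : ℝ), ∃ c' > c, ∀ σ : ℝ, c' < σ → ∀ t : ℝ,
      ‖f ((σ : ℂ) + (t : ℂ) * Complex.I)‖ ≤ K)
    (hgrowth : ∃ ν : ℝ → ℝ, AntitoneOn ν (Set.Ioi c) ∧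
      (∀ᶠ σ in 𝓝[>] c, ν σ ≤ 1 + c - σ) ∧
      ∀ σ : ℝ, c < σ → ∀ ε : ℝ, 0 < ε →
        (fun t : ℝ => f ((σ : ℂ) + (t : ℂ) * Complex.I))
          =O[cocompact ℝ] (fun t : ℝ => |t| ^ (ν σ + ε)))
    (hpole : (polesIn f (rightHalfPlane c)).Subsingleton)
    (n k : ℕ → ℕ) (hnk : IsStoltz n k)
    (s : ℂ) (hs : s ∈ rightHalfPlane c)
    (hs₀ : ∀ s₀ ∈ polesIn f (rightHalfPlane c), s.re ≠ s₀.re) :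
    Integrable (fun τ : ℝ =>
      f (s + Complex.I * (τ : ℂ)) / ((α ^ 2 + (τ - β) ^ 2 : ℝ) : ℂ)) ∧
    ∀ᵐ x : ℝ, Tendsto
      (fun l : ℕ => (1 / (k l : ℂ)) *
        ∑ j ∈ Finset.Icc 1 (k l), f (s + Complex.I * (((booleMap α β)^[n l + j] x : ℝ) : ℂ)))
      atTop
      (𝓝 (((α / Real.pi : ℝ) : ℂ) *
        ∫ τ : ℝ, f (s + Complex.I * (τ : ℂ)) / ((α ^ 2 + (τ - β) ^ 2 : ℝ) : ℂ))) := by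
  set φ : ℝ → ℂ := fun τ => f (s + Complex.I * (τ : ℂ)) with hφdef
  have hsc : c < s.re := hs
  have hφ : Continuous φ := by
    refine continuous_iff_continuousAt.2 fun τ => ?_
    have hre : (s + Complex.I * (τ : ℂ)).re = s.re := by simp
    have hmem : s + Complex.I * (τ : ℂ) ∈ rightHalfPlane c := by
      change c < (s + Complex.I * (τ : ℂ)).re
      rwa [hre]
    have han := hf.2 _ hmem fun hp => hs₀ _ hp hre.symm
    exact han.continuousAt.comp (f := fun τ : ℝ => s + Complex.I * (τ : ℂ)) (by fun_prop)
  obtain ⟨ν, hanti, hnear, hO⟩ := hgrowth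
  -- Monotonicity carries the bound from near c: for c < σ < Re s, ν(Re s) ≤ ν(σ) ≤ 1 + c - σ < 1.
  have hν : ν s.re < 1 := by
    have hIoo : ∀ᶠ σ in 𝓝[>] c, σ ∈ Set.Ioo c s.re := Ioo_mem_nhdsGT hsc
    obtain ⟨σ, hσ, hσ'⟩ := (hnear.and hIoo).exists
    have := hanti (show σ ∈ Set.Ioi c from hσ'.1) (show s.re ∈ Set.Ioi c from hsc) hσ'.2.le
    linarith [hσ'.1]
  -- The midpoint of ν(Re s) and 1 leaves room for the ε of the growth condition; q ≥ 0 makes t ↦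
  -- t^q monotone.
  set q : ℝ := max ((1 + ν s.re) / 2) 0 with hq
  have hq1 : q < 1 := max_lt (by linarith) one_pos
  have hgrow : φ =O[cocompact ℝ] fun t => (1 + ‖t‖) ^ q := by
    have h1 := hO s.re hsc ((1 - ν s.re) / 2) (by linarith)
    have h2 : (fun t : ℝ => |t| ^ (ν s.re + (1 - ν s.re) / 2)) =O[cocompact ℝ]
        fun t : ℝ => (1 + |t|) ^ q := by
      refine IsBigO.of_bound 1 ?_
      have hlarge : ∀ᶠ t : ℝ in cocompact ℝ, 1 ≤ ‖t‖ :=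
        (tendsto_norm_cocompact_atTop (E := ℝ)).eventually_ge_atTop 1
      filter_upwards [hlarge] with t ht
      rw [Real.norm_eq_abs] at ht
      rw [Real.norm_of_nonneg (by positivity), Real.norm_of_nonneg (by positivity), one_mul]
      calc |t| ^ (ν s.re + (1 - ν s.re) / 2) ≤ |t| ^ q :=
            Real.rpow_le_rpow_of_exponent_le ht ((le_of_eq (by ring)).trans (le_max_left _ _))
        _ ≤ (1 + |t|) ^ q := Real.rpow_le_rpow (abs_nonneg _) (by linarith) (le_max_right _ _)
    -- The growth condition is centred at the real axis, while φ starts at height Im s; the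
    -- translation costs a factor (1 + |Im s|)^q.
    have h3 := (h1.trans h2).comp_tendsto
      (Homeomorph.addLeft s.im).isClosedEmbedding.tendsto_cocompact
    have h4 : (fun t : ℝ => (1 + |s.im + t|) ^ q) =O[cocompact ℝ]
        fun t : ℝ => (1 + ‖t‖) ^ q := by
      refine IsBigO.of_bound ((1 + |s.im|) ^ q) (Eventually.of_forall fun t => ?_)
      rw [Real.norm_of_nonneg (by positivity), Real.norm_of_nonneg (by positivity),
        ← Real.mul_rpow (by positivity) (by positivity), Real.norm_eq_abs]
      refine Real.rpow_le_rpow (by positivity) ?_ (le_max_right _ _)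
      nlinarith [abs_add_le s.im t, abs_nonneg s.im, abs_nonneg t,
        mul_nonneg (abs_nonneg s.im) (abs_nonneg t)]
    refine (IsBigO.trans (h3.congr_left fun t => ?_) h4)
    simp only [Function.comp_apply, Homeomorph.coe_addLeft, hφdef]
    congr 1
    apply Complex.ext <;> simp
  have hint := integrable_div_cauchy hφ hq1 hgrow hα β
  exact ⟨hint, ae_tendsto_movingAverage_booleMap hα β hφ.measurable hint hnk⟩
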